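/- Let $\Bbbk$ be an algebraically closed field of characteristic zero, $G$ a finite group, $g$ a central element of $G$, $\chi:G\to\Bbbk^\times$ a linear character, $n$ the order of $\chi(g)$, and assume $n\ge 2$. Let $\mu\in\Bbbk$ satisfy $\mu(g^n-1)=0$ in $\Bbbk G$ (nilpotent type; one may take $\mu=0$). Let $H$ be the $\Bbbk$-algebra generated by $y$ and the elements of $G$, subject to the relations of $\Bbbk G$ together with $$y^n=\mu(g^n-1),\qquad yh=\chi(h)hy\quad(h\in G),$$ with the comultiplication and counit determined by $\Delta(y)=y\otimes g+1\otimes y$, $\Delta(h)=h\otimes h$, $\varepsilon(y)=0$, $\varepsilon(h)=1$ for $h\in G$. For left $H$-modules $M,N$, the tensor product $M\otimes N=M\otimes_{\Bbbk}N$ is an $H$-module via $\Delta$. Let $V_1,\dots,V_m$ be a complete set of pairwise non-isomorphic simple $\Bbbk G$-modules, with $V_1$ the trivial module $\Bbbk$, and let $\tau$ be the permutation of $\{1,\dots,m\}$ with $V_{\chi^{-1}}\otimes V_i\cong V_{\tau(i)}$, where $V_{\chi^{-1}}$ is the one-dimensional module given by the character $\chi^{-1}$. For $1\le i\le m$ and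 $1\le j\le n$ let $$M(i,j)=V_i\oplus xV_i\oplus\cdots\oplus x^{j-1}V_i,$$ where each $x^kV_i=\{x^kv : v\in V_i\}$ is a copy of the vector space $V_i$, with $H$-action $$h(x^kv)=\chi^{-k}(h)\,x^k(hv)\quad(h\in G),\qquad y(x^kv)=\begin{cases}x^{k+1}v,&0\le k\le j-2,\\ 0,&k=j-1.\end{cases}$$ Then for every $1\le i\le m$ there are the following isomorphisms of $H$-modules. 1. For $2\le j\le n-1$: $\;M(1,2)\otimes M(i,j)\cong M(i,j)\otimes M(1,2)\cong M(i,j+1)\oplus M(\tau(i),j-1)$. 2. $M(1,2)\otimes M(i,n)\cong M(i,n)\otimes M(1,2)\cong M(i,n)\oplus M(\tau(i),n)$. -/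

import Mathlib

open scoped TensorProduct

universe u v w

/-! ### The `q`-binomial theorem at a primitive root of unity
(used only to see that the comultiplication respects the relation for `y ^ n`) -/

namespace RankOne

/-- `q`-binomial coefficients: `qc q i j` is the coefficient of `a ^ i * b ^ j` in
`(a + b) ^ (i + j)` when `b * a = q • (a * b)`. -/
def qc {k : Type u} [Field k] (q : k) : ℕ → ℕ → k
  | 0, _ => 1
  | _ + 1, 0 => 1
  | i + 1, j + 1 => qc q (i + 1) j + q ^ (j + 1) * qc q i (j + 1)

theorem qc_rec {k : Type u} [Field k] (q : k) (i j : ℕ) :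
    (1 - q ^ (j + 1)) * qc q i (j + 1) = (1 - q ^ (i + j + 1)) * qc q i j := by
  induction i generalizing j with
  | zero => simp [qc]
  | succ i ih =>
    induction j with
    | zero =>
      have h := ih 0
      have h0 : qc q i 0 = 1 := by cases i <;> simp [qc]
      rw [h0] at h
      simp only [qc]
      linear_combination q * h
    | succ j ihj =>
      have h1 := ih (j + 1)
      rw [qc]
      have h2 : qc q (i + 1) (j + 1) = qc q (i + 1) j + q ^ (j + 1) * qc q i (j + 1) := by rw [qc]
      linear_combination q ^ (j + 2) * h1 + q * ihj + (q ^ (i + j + 3) - q) * h2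

theorem pow_mul_qcomm {k : Type u} [Field k] {A : Type v} [Ring A] [Algebra k A] (q : k)
    {a b : A} (h : b * a = q • (a * b)) (j : ℕ) : b ^ j * a = q ^ j • (a * b ^ j) := by
  induction j with
  | zero => simp
  | succ j ih =>
    rw [pow_succ, mul_assoc, h, mul_smul_comm, ← mul_assoc, ih, smul_mul_assoc, smul_smul,
      mul_assoc, ← pow_succ']

theorem add_pow_qcomm {k : Type u} [Field k] {A : Type v} [Ring A] [Algebra k A] (q : k)
    {a b : A} (h : b * a = q • (a * b)) (m : ℕ) :
    (a + b) ^ m = ∑ p ∈ Finset.HasAntidiagonal.antidiagonal m,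
      qc q p.1 p.2 • (a ^ p.1 * b ^ p.2) := by
  induction m with
  | zero => simp [qc]
  | succ m ih =>
    let g₁ : ℕ × ℕ → A := fun p => match p with
      | (0, _) => 0
      | (i + 1, j) => (q ^ j * qc q i j) • (a ^ (i + 1) * b ^ j)
    let g₂ : ℕ × ℕ → A := fun p => match p with
      | (_, 0) => 0
      | (i, j + 1) => qc q i j • (a ^ i * b ^ (j + 1))
    have hg : ∀ p ∈ Finset.HasAntidiagonal.antidiagonal (m + 1),
        qc q p.1 p.2 • (a ^ p.1 * b ^ p.2) = g₁ p + g₂ p := by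
      rintro ⟨i, j⟩ hp
      rw [Finset.HasAntidiagonal.mem_antidiagonal] at hp
      rcases i with _ | i <;> rcases j with _ | j
      · simp at hp
      · simp [g₁, g₂, qc]
      · have h0 : qc q i 0 = 1 := by cases i <;> simp [qc]
        simp [g₁, g₂, qc, h0]
      · simp only [g₁, g₂, qc]
        rw [add_smul, add_comm]
    rw [Finset.sum_congr rfl hg, Finset.sum_add_distrib,
      Finset.Nat.sum_antidiagonal_succ (f := g₁), Finset.Nat.sum_antidiagonal_succ' (f := g₂),
      pow_succ, ih, mul_add, Finset.sum_mul, Finset.sum_mul]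
    simp only [g₁, g₂, zero_add]
    congr 1
    · refine Finset.sum_congr rfl fun p _ => ?_
      rw [smul_mul_assoc, mul_assoc, pow_mul_qcomm q h, mul_smul_comm, smul_smul, pow_succ,
        mul_assoc, mul_comm (qc q _ _)]
    · refine Finset.sum_congr rfl fun p _ => ?_
      rw [smul_mul_assoc, mul_assoc, ← pow_succ]

theorem add_pow_of_qcomm {k : Type u} [Field k] {A : Type v} [Ring A] [Algebra k A] {q : k}
    {n : ℕ} (hn : 0 < n) (hq : IsPrimitiveRoot q n) {a b : A} (h : b * a = q • (a * b)) :
    (a + b) ^ n = a ^ n + b ^ n := by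
  have hz : ∀ i j, i + j + 1 = n → i ≠ 0 → qc q i (j + 1) = 0 := by
    intro i j hij hi
    have h1 := qc_rec q i j
    rw [hij, hq.pow_eq_one, sub_self, zero_mul] at h1
    rcases mul_eq_zero.mp h1 with h2 | h2
    · exact absurd (sub_eq_zero.mp h2).symm (hq.pow_ne_one_of_pos_of_lt (by omega) (by omega))
    · exact h2
  obtain ⟨m, rfl⟩ : ∃ m, n = m + 1 := ⟨n - 1, by omega⟩
  rw [add_pow_qcomm q h, Finset.Nat.sum_antidiagonal_succ']
  simp only [pow_zero, mul_one]
  congr 1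
  · simp [qc]
  · rw [Finset.sum_eq_single (0, m)]
    · simp [qc]
    · rintro ⟨i, j⟩ hp hne
      rw [Finset.HasAntidiagonal.mem_antidiagonal] at hp
      have hi : i ≠ 0 := by
        rintro rfl
        apply hne
        simp at hp
        simp [hp]
      simp only at hp ⊢
      rw [hz i j (by omega) hi, zero_smul]
    · intro hm
      simp at hm

/-! ### Group data and the Hopf algebra of a group datum -/

/-- A group datum `(G, χ, g, μ)` over `k`: `g` is central in `G`, `χ` is a linear character of
`G`, and `χ ^ n = 1` or `μ (g ^ n - 1) = 0` in `k[G]`, where `n` is the order of `χ g`. -/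
structure GroupDatum (k : Type u) (G : Type v) [Field k] [Group G] where
  χ : G →* kˣ
  g : G
  μ : k
  g_central : g ∈ Subgroup.center G
  compat : χ ^ orderOf (χ g) = 1 ∨
    μ • (MonoidAlgebra.of k G (g ^ orderOf (χ g)) - 1) = 0

namespace GroupDatum

variable {k : Type u} {G : Type v} [Field k] [Group G] (D : GroupDatum k G)

/-- The order `n` of `q = χ g`. -/
noncomputable def n : ℕ := orderOf (D.χ D.g)

/-- The datum is of nilpotent type if `μ (g ^ n - 1) = 0` in the group algebra `k[G]`. -/
def IsNilpotentType : Prop :=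
  D.μ • (MonoidAlgebra.of k G (D.g ^ D.n) - 1) = 0

/-- The free algebra on `y` (the generator `none`) and the elements of `G`. -/
abbrev Free (_D : GroupDatum k G) : Type (max u v) := FreeAlgebra k (Option G)

/-- The generator `y` in the free algebra. -/
abbrev fy : D.Free := FreeAlgebra.ι k none

/-- The generator attached to `h` in the free algebra. -/
abbrev fg (h : G) : D.Free := FreeAlgebra.ι k (some h)

/-- The defining relations: those of the group algebra `k[G]`, `y ^ n = μ (g ^ n - 1)` and
`y h = χ(h) h y`. -/
inductive Rel : D.Free → D.Free → Prop
  | one : Rel (D.fg 1) 1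
  | mul (a b : G) : Rel (D.fg a * D.fg b) (D.fg (a * b))
  | nil : Rel (D.fy ^ D.n) (D.μ • (D.fg (D.g ^ D.n) - 1))
  | comm (h : G) : Rel (D.fy * D.fg h) ((D.χ h : k) • (D.fg h * D.fy))

/-- The algebra `H_D`. -/
def H : Type (max u v) := RingQuot D.Rel

noncomputable instance : Ring D.H := inferInstanceAs (Ring (RingQuot D.Rel))

noncomputable instance instAlgebraH : Algebra k D.H :=
  inferInstanceAs (Algebra k (RingQuot D.Rel))

/-- The quotient map from the free algebra. -/
noncomputable def proj : D.Free →ₐ[k] D.H := RingQuot.mkAlgHom k D.Rel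

/-- The generator `y` of `H_D`. -/
noncomputable def y : D.H := D.proj D.fy

/-- The element of `H_D` given by `h ∈ G`. -/
noncomputable def gr (h : G) : D.H := D.proj (D.fg h)

theorem gr_one : D.gr 1 = 1 := by
  have := RingQuot.mkAlgHom_rel k (Rel.one (D := D))
  rw [map_one] at this
  exact this

theorem gr_mul (a b : G) : D.gr (a * b) = D.gr a * D.gr b := by
  have := RingQuot.mkAlgHom_rel k (Rel.mul (D := D) a b)
  rw [map_mul] at this
  exact this.symm

theorem y_pow : D.y ^ D.n = D.μ • (D.gr (D.g ^ D.n) - 1) := by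
  have := RingQuot.mkAlgHom_rel k (Rel.nil (D := D))
  rw [map_pow, map_smul, map_sub, map_one] at this
  exact this

theorem y_mul_gr (h : G) : D.y * D.gr h = (D.χ h : k) • (D.gr h * D.y) := by
  have := RingQuot.mkAlgHom_rel k (Rel.comm (D := D) h)
  rw [map_smul, map_mul, map_mul] at this
  exact this

section lift

variable {A : Type w} [Ring A] [Algebra k A]

/-- The universal property of `H_D`. -/
noncomputable def lift (Y : A) (φ : G →* A) (hY : Y ^ D.n = D.μ • (φ (D.g ^ D.n) - 1))
    (hc : ∀ h, Y * φ h = (D.χ h : k) • (φ h * Y)) : D.H →ₐ[k] A :=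
  RingQuot.liftAlgHom k ⟨FreeAlgebra.lift k (fun o : Option G => o.elim Y φ), by
    intro a b hab
    induction hab with
    | one => simp
    | mul a b => simp
    | nil => simpa using hY
    | comm h => simpa using hc h⟩

variable (Y : A) (φ : G →* A) (hY : Y ^ D.n = D.μ • (φ (D.g ^ D.n) - 1))
    (hc : ∀ h, Y * φ h = (D.χ h : k) • (φ h * Y))

@[simp] theorem lift_y : D.lift Y φ hY hc D.y = Y := by
  have : D.lift Y φ hY hc D.y = FreeAlgebra.lift k (fun o : Option G => o.elim Y φ) D.fy :=
    RingQuot.liftAlgHom_mkAlgHom_apply _ _ _ _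
  simpa using this

@[simp] theorem lift_gr (h : G) : D.lift Y φ hY hc (D.gr h) = φ h := by
  have : D.lift Y φ hY hc (D.gr h) =
      FreeAlgebra.lift k (fun o : Option G => o.elim Y φ) (D.fg h) :=
    RingQuot.liftAlgHom_mkAlgHom_apply _ _ _ _
  simpa using this

variable {D} in
theorem hom_ext {f f' : D.H →ₐ[k] A} (hy : f D.y = f' D.y) (hg : ∀ h, f (D.gr h) = f' (D.gr h)) :
    f = f' := by
  apply RingQuot.ringQuot_ext'
  apply FreeAlgebra.hom_ext
  funext o
  cases o with
  | none => exact hy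
  | some h => exact hg h

end lift

/-- `h ↦ h` as a monoid homomorphism `G → H_D`. -/
noncomputable def grHom : G →* D.H where
  toFun := D.gr
  map_one' := D.gr_one
  map_mul' := D.gr_mul

/-- `h ↦ h ⊗ h` as a monoid homomorphism. -/
noncomputable def grHom₂ : G →* D.H ⊗[k] D.H where
  toFun h := D.gr h ⊗ₜ D.gr h
  map_one' := by rw [gr_one, Algebra.TensorProduct.one_def]
  map_mul' a b := by rw [gr_mul, Algebra.TensorProduct.tmul_mul_tmul]

theorem isPrimitiveRoot [Finite G] : IsPrimitiveRoot ((D.χ D.g : kˣ) : k) D.n :=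
  IsPrimitiveRoot.coe_units_iff.mpr (IsPrimitiveRoot.orderOf (D.χ D.g))

theorem n_pos [Finite G] : 0 < D.n :=
  (MonoidHom.isOfFinOrder D.χ (isOfFinOrder_of_finite D.g)).orderOf_pos

theorem gr_pow (h : G) (m : ℕ) : D.gr h ^ m = D.gr (h ^ m) :=
  (map_pow D.grHom h m).symm

/-- The comultiplication: `y ↦ y ⊗ g + 1 ⊗ y` and `h ↦ h ⊗ h` for `h ∈ G`. -/
noncomputable def comulHom [Finite G] : D.H →ₐ[k] D.H ⊗[k] D.H :=
  D.lift (D.y ⊗ₜ D.gr D.g + 1 ⊗ₜ D.y) D.grHom₂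
    (by
      rw [add_pow_of_qcomm D.n_pos D.isPrimitiveRoot]
      · simp only [Algebra.TensorProduct.tmul_pow, one_pow, y_pow, gr_pow, grHom₂,
          MonoidHom.coe_mk, OneHom.coe_mk, Algebra.TensorProduct.one_def,
          TensorProduct.smul_tmul', TensorProduct.tmul_smul, TensorProduct.sub_tmul,
          TensorProduct.tmul_sub, smul_sub]
        abel
      · simp only [Algebra.TensorProduct.tmul_mul_tmul, one_mul, mul_one, y_mul_gr,
          TensorProduct.tmul_smul])
    (by
      intro h
      have hc : D.g * h = h * D.g := (Subgroup.mem_center_iff.mp D.g_central h).symm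
      simp only [grHom₂, MonoidHom.coe_mk, OneHom.coe_mk, add_mul, mul_add,
        Algebra.TensorProduct.tmul_mul_tmul, one_mul, mul_one, y_mul_gr, ← gr_mul, hc,
        TensorProduct.tmul_smul, TensorProduct.smul_tmul', smul_add])

/-- The counit: `y ↦ 0` and `h ↦ 1` for `h ∈ G`. -/
noncomputable def counitHom [Finite G] : D.H →ₐ[k] k :=
  D.lift 0 1 (by simp [D.n_pos.ne']) (by simp)

theorem comulHom_y [Finite G] : D.comulHom D.y = D.y ⊗ₜ D.gr D.g + 1 ⊗ₜ D.y := lift_y ..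
theorem comulHom_gr [Finite G] (h : G) : D.comulHom (D.gr h) = D.gr h ⊗ₜ D.gr h := lift_gr ..
theorem counitHom_y [Finite G] : D.counitHom D.y = 0 := lift_y ..
theorem counitHom_gr [Finite G] (h : G) : D.counitHom (D.gr h) = 1 := lift_gr ..

noncomputable instance instBialgebraH [Finite G] : Bialgebra k D.H :=
  Bialgebra.ofAlgHom D.comulHom D.counitHom
    (hom_ext
      (by simp [comulHom_y, comulHom_gr, Algebra.TensorProduct.one_def, TensorProduct.add_tmul,
            TensorProduct.tmul_add, add_assoc])
      (fun h => by simp [comulHom_gr]))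
    (hom_ext (by simp [comulHom_y, counitHom_y])
      (fun h => by simp [comulHom_gr, counitHom_gr]))
    (hom_ext (by simp [comulHom_y, counitHom_y, counitHom_gr])
      (fun h => by simp [comulHom_gr, counitHom_gr]))

end GroupDatum

/-! ### Tensor products of modules over a bialgebra -/

/-- The tensor product over `k` of two modules over a bialgebra `H`; `H` acts through its
comultiplication. -/
def HTensor (k : Type*) (_H : Type*) (M : Type*) (N : Type*) [CommRing k] [AddCommGroup M]
    [AddCommGroup N] [Module k M] [Module k N] : Type _ := M ⊗[k] N

namespace HTensor

variable (k : Type*) (H : Type*) (M : Type*) (N : Type*) [CommRing k] [Ring H] [Bialgebra k H]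
  [AddCommGroup M] [AddCommGroup N] [Module k M] [Module k N] [Module H M] [Module H N]
  [IsScalarTower k H M] [IsScalarTower k H N]

noncomputable instance : AddCommGroup (HTensor k H M N) :=
  inferInstanceAs (AddCommGroup (M ⊗[k] N))

noncomputable instance : Module k (HTensor k H M N) :=
  inferInstanceAs (Module k (M ⊗[k] N))

/-- If `Δ a = ∑ a₁ ⊗ a₂` then `a` acts on `M ⊗ N` by `m ⊗ n ↦ ∑ a₁ m ⊗ a₂ n`. -/
noncomputable def act : H →ₐ[k] Module.End k (M ⊗[k] N) :=
  (Module.endTensorEndAlgHom (R := k) (S := k) (A := k) (M := M) (N := N)).comp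
    ((Algebra.TensorProduct.map (Algebra.lsmul k k M) (Algebra.lsmul k k N)).comp
      (Bialgebra.comulAlgHom k H))

noncomputable instance : Module H (HTensor k H M N) :=
  Module.compHom (M ⊗[k] N) (act k H M N).toRingHom

theorem smul_def (a : H) (t : HTensor k H M N) :
    a • t = (show HTensor k H M N from act k H M N a (show M ⊗[k] N from t)) := rfl

instance : IsScalarTower k H (HTensor k H M N) where
  smul_assoc c a t := LinearMap.congr_fun (map_smul (act k H M N) c a) t

end HTensor

theorem GroupDatum.tensorAct_y {k : Type u} {G : Type v} [Field k] [Group G] [Finite G]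
    (D : GroupDatum k G) {M N : Type*} [AddCommGroup M] [AddCommGroup N] [Module k M] [Module k N]
    [Module D.H M] [Module D.H N] [IsScalarTower k D.H M] [IsScalarTower k D.H N] (a : M) (b : N) :
    HTensor.act k D.H M N D.y (a ⊗ₜ[k] b) =
      (D.y • a) ⊗ₜ[k] (D.gr D.g • b) + a ⊗ₜ[k] (D.y • b) := by
  have h : Bialgebra.comulAlgHom k D.H D.y = D.y ⊗ₜ D.gr D.g + 1 ⊗ₜ D.y := D.comulHom_y
  simp only [HTensor.act, AlgHom.comp_apply, h, map_add, Algebra.TensorProduct.map_tmul, map_one]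
  rfl

theorem GroupDatum.tensorAct_gr {k : Type u} {G : Type v} [Field k] [Group G] [Finite G]
    (D : GroupDatum k G) {M N : Type*} [AddCommGroup M] [AddCommGroup N] [Module k M] [Module k N]
    [Module D.H M] [Module D.H N] [IsScalarTower k D.H M] [IsScalarTower k D.H N] (a : M) (b : N)
    (x : G) :
    HTensor.act k D.H M N (D.gr x) (a ⊗ₜ[k] b) = (D.gr x • a) ⊗ₜ[k] (D.gr x • b) := by
  have h : Bialgebra.comulAlgHom k D.H (D.gr x) = D.gr x ⊗ₜ D.gr x := D.comulHom_gr x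
  simp only [HTensor.act, AlgHom.comp_apply, h, Algebra.TensorProduct.map_tmul]
  rfl

/-! ### The modules `M(V, j)` -/

namespace GroupDatum

variable {k : Type u} {G : Type v} [Field k] [Group G] (D : GroupDatum k G)

section modules

variable {V : Type w} [AddCommGroup V] [Module k V] (ρ : Representation k G V)

/-- The map `x ^ l v ↦ x ^ (l + 1) v` for `l + 1 < j`, `x ^ (j - 1) v ↦ 0`, on
`V ⊕ x V ⊕ ⋯ ⊕ x ^ (j - 1) V = (Fin j → V)`. -/
def shift (k : Type u) [Field k] (V : Type w) [AddCommGroup V] [Module k V] (j : ℕ) :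
    Module.End k (Fin j → V) :=
  LinearMap.pi fun l => if 0 < l.1 then LinearMap.proj ⟨l.1 - 1, by omega⟩ else 0

/-- The `G`-action `h (x ^ l v) = χ(h) ^ (-l) x ^ l (h v)` on `V ⊕ x V ⊕ ⋯ ⊕ x ^ (j - 1) V`. -/
noncomputable def grAct (j : ℕ) : G →* Module.End k (Fin j → V) where
  toFun h := LinearMap.pi fun l => ((((D.χ h)⁻¹ ^ l.1 : kˣ) : k)) • (ρ h ∘ₗ LinearMap.proj l)
  map_one' := by
    ext
    simp
  map_mul' a b := by
    ext
    simp [mul_pow, smul_smul, mul_comm]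

theorem shift_pow_apply (j m : ℕ) (f : Fin j → V) (l : Fin j) (hl : l.1 < m) :
    (shift k V j ^ m) f l = 0 := by
  induction m generalizing l with
  | zero => simp at hl
  | succ m ih =>
    rw [pow_succ', Module.End.mul_apply, shift, LinearMap.pi_apply]
    split_ifs with h
    · exact ih _ (by simp only; omega)
    · rfl

variable {D}

/-- `M(V, j) = V ⊕ x V ⊕ ⋯ ⊕ x ^ (j - 1) V` for `j ≤ n`; an element `f` stands for
`∑ l, x ^ l f(l)`. -/
def Mod (_hD : D.IsNilpotentType) (_ρ : Representation k G V) (j : ℕ) (_hj : j ≤ D.n) : Type w :=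
  Fin j → V

variable (hD : D.IsNilpotentType) (j : ℕ) (hj : j ≤ D.n)

instance : AddCommGroup (Mod hD ρ j hj) := inferInstanceAs (AddCommGroup (Fin j → V))

instance : Module k (Mod hD ρ j hj) := inferInstanceAs (Module k (Fin j → V))

/-- `y` acts on `M(V, j)` by `shift` and `h ∈ G` acts by `grAct`. -/
noncomputable def modAct : D.H →ₐ[k] Module.End k (Fin j → V) :=
  D.lift (shift k V j) (D.grAct ρ j)
    (by
      have h := congrArg (MonoidAlgebra.lift k _ G (D.grAct ρ j)) hD
      rw [map_smul, map_sub, map_one, MonoidAlgebra.lift_of, map_zero] at h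
      rw [h]
      refine LinearMap.ext fun f => funext fun l => ?_
      exact shift_pow_apply j D.n f l (lt_of_lt_of_le l.2 hj))
    (by
      intro h
      refine LinearMap.ext fun f => funext fun l => ?_
      by_cases hl : 0 < l.1
      · obtain ⟨m, hm⟩ : ∃ m, l.1 = m + 1 := ⟨l.1 - 1, by omega⟩
        have hu : ((D.χ h : kˣ) : k) ≠ 0 := Units.ne_zero _
        simp [shift, grAct, hm, smul_smul, pow_succ']
        congr 1
        field_simp
      · simp [shift, grAct, hl])

noncomputable instance : Module D.H (Mod hD ρ j hj) :=
  Module.compHom (Fin j → V) (modAct ρ hD j hj).toRingHom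

theorem Mod.smul_def (a : D.H) (f : Mod hD ρ j hj) :
    a • f = (show Mod hD ρ j hj from modAct ρ hD j hj a (show Fin j → V from f)) := rfl

instance : IsScalarTower k D.H (Mod hD ρ j hj) where
  smul_assoc c a t := LinearMap.congr_fun (map_smul (modAct ρ hD j hj) c a) t

theorem modAct_y (l : Fin j) (v : V) : modAct ρ hD j hj D.y (Pi.single l v) =
    if h : l.1 + 1 < j then Pi.single ⟨l.1 + 1, h⟩ v else 0 := by
  rw [modAct, lift_y]
  funext i
  have hi := i.2
  rw [shift, LinearMap.pi_apply]
  split_ifs with h0 h1 h1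
  · simp only [LinearMap.proj_apply, Pi.single_apply, Fin.ext_iff]
    congr 1
    exact propext (by omega)
  · simp only [LinearMap.proj_apply, Pi.single_apply, Fin.ext_iff, Pi.zero_apply]
    rw [if_neg (by omega)]
  · simp only [Pi.single_apply, Fin.ext_iff, LinearMap.zero_apply]
    rw [if_neg (by omega)]
  · rfl

theorem modAct_gr (h : G) (l : Fin j) (v : V) : modAct ρ hD j hj (D.gr h) (Pi.single l v) =
    Pi.single l ((((D.χ h)⁻¹ ^ l.1 : kˣ) : k) • ρ h v) := by
  rw [modAct, lift_gr]
  funext i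
  change (((D.χ h)⁻¹ ^ i.1 : kˣ) : k) • ρ h ((Pi.single l v : Fin j → V) i) = _
  by_cases hi : i = l
  · subst hi; simp
  · simp [hi]

end modules

end GroupDatum

/-! ### Complete sets of simple modules and the permutation `τ` -/

/-- The one-dimensional representation `V_ψ` of `G` on `k` given by a linear character `ψ`. -/
def charRep {k : Type u} {G : Type v} [Field k] [Group G] (ψ : G →* kˣ) :
    Representation k G k where
  toFun h := (ψ h : k) • LinearMap.id
  map_one' := by ext; simp
  map_mul' a b := by ext; simp [mul_comm]

/-- `(V i, ρ i)`, `i : ι`, is a complete set of pairwise non-isomorphic irreducible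
representations of `G` over `k`. -/
structure IsCompleteIrreps {k : Type u} {G : Type v} [Field k] [Group G] {ι : Type*}
    {V : ι → Type u} [∀ i, AddCommGroup (V i)] [∀ i, Module k (V i)]
    (ρ : ∀ i, Representation k G (V i)) : Prop where
  irreducible : ∀ i, (ρ i).IsIrreducible
  eq_of_equiv : ∀ i i', Nonempty ((ρ i).Equiv (ρ i')) → i = i'
  complete : ∀ (W : Type u) [AddCommGroup W] [Module k W] (σ : Representation k G W),
    σ.IsIrreducible → ∃ i, Nonempty (σ.Equiv (ρ i))

section tau

variable {k : Type u} {G : Type v} [Field k] [Group G]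

/-- The representation `h ↦ ψ(h) ρ(h)` on `V`. -/
def twist (ψ : G →* kˣ) {V : Type w} [AddCommGroup V] [Module k V] (ρ : Representation k G V) :
    Representation k G V where
  toFun h := (ψ h : k) • ρ h
  map_one' := by ext; simp
  map_mul' a b := by ext; simp [smul_smul, mul_comm]

/-- `V_ψ ⊗ V` is the twist of `V` by `ψ`. -/
noncomputable def charTensorEquiv (ψ : G →* kˣ) {V : Type w} [AddCommGroup V] [Module k V]
    (ρ : Representation k G V) : ((charRep ψ).tprod ρ).Equiv (twist ψ ρ) :=
  Representation.Equiv.mk (TensorProduct.lid k V) (by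
    intro h
    ext v
    simp [charRep, twist])

theorem twist_irreducible (ψ : G →* kˣ) {V : Type w} [AddCommGroup V] [Module k V]
    (ρ : Representation k G V) (hρ : ρ.IsIrreducible) : (twist ψ ρ).IsIrreducible := by
  let e : Subrepresentation (twist ψ ρ) ≃o Subrepresentation ρ :=
    { toFun := fun W => ⟨W.toSubmodule, fun h v hv => by
        have h1 := W.toSubmodule.smul_mem (((ψ h)⁻¹ : kˣ) : k) (W.apply_mem_toSubmodule h hv)
        simpa [twist, smul_smul] using h1⟩
      invFun := fun W => ⟨W.toSubmodule, fun h v hv =>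
        W.toSubmodule.smul_mem (ψ h : k) (W.apply_mem_toSubmodule h hv)⟩
      left_inv := fun _ => rfl
      right_inv := fun _ => rfl
      map_rel_iff' := Iff.rfl }
  exact (OrderIso.isSimpleOrder_iff e).mpr hρ

variable {m : ℕ} {V : Fin m → Type u} [∀ i, AddCommGroup (V i)] [∀ i, Module k (V i)]
  {ρ : ∀ i, Representation k G (V i)}

theorem IsCompleteIrreps.exists_tau (hρ : IsCompleteIrreps ρ) (D : GroupDatum k G) :
    ∃ τ : Equiv.Perm (Fin m),
      ∀ i, Nonempty (((charRep D.χ⁻¹).tprod (ρ i)).Equiv (ρ (τ i))) := by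
  have h : ∀ i, ∃ i', Nonempty ((twist D.χ⁻¹ (ρ i)).Equiv (ρ i')) := fun i =>
    hρ.complete _ _ (twist_irreducible _ _ (hρ.irreducible i))
  choose t ht using h
  have hinj : Function.Injective t := by
    intro i i' hii
    obtain ⟨e⟩ := ht i
    obtain ⟨e'⟩ := ht i'
    rw [← hii] at e'
    refine hρ.eq_of_equiv i i' ⟨Representation.Equiv.mk (e.trans e'.symm).toLinearEquiv ?_⟩
    intro h
    ext v
    have h1 : (e.trans e'.symm) ((D.χ⁻¹ h : k) • ρ i h v) =
        (D.χ⁻¹ h : k) • ρ i' h ((e.trans e'.symm) v) :=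
      LinearMap.congr_fun ((e.trans e'.symm).toIntertwiningMap.isIntertwining' h) v
    rw [map_smul] at h1
    exact smul_right_injective _ (Units.ne_zero (D.χ⁻¹ h)) h1
  exact ⟨Equiv.ofBijective t (Finite.injective_iff_bijective.mp hinj),
    fun i => (ht i).map fun e => (charTensorEquiv _ _).trans e⟩

/-- The permutation `τ` of the index set determined by `V_{χ⁻¹} ⊗ V_i ≅ V_{τ(i)}`. -/
noncomputable def tau (hρ : IsCompleteIrreps ρ) (D : GroupDatum k G) : Equiv.Perm (Fin m) :=
  (hρ.exists_tau D).choose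

theorem tau_spec (hρ : IsCompleteIrreps ρ) (D : GroupDatum k G) (i : Fin m) :
    Nonempty (((charRep D.χ⁻¹).tprod (ρ i)).Equiv (ρ (tau hρ D i))) :=
  (hρ.exists_tau D).choose_spec i

theorem tau_spec' (hρ : IsCompleteIrreps ρ) (D : GroupDatum k G) (i : Fin m) :
    Nonempty (((ρ i).tprod (charRep D.χ⁻¹)).Equiv (ρ (tau hρ D i))) :=
  (tau_spec hρ D i).map fun e => (Representation.TensorProduct.comm _ _).trans e

end tau

end RankOne

/-! Write r = χ(g)⁻¹, a primitive n-th root of unity, and [s] = 1 + r + ⋯ + r^(s-1), so that [s] ≠ 0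
for 0 < s < n and [n] = 0. Since M(1,2) has basis 1, x, both tensor products with M(V,j) become
pairs of elements of V ⊕ xV ⊕ ⋯ with an explicit action of y and G, and all isomorphisms are
explicit matrices with entries in the [s] and powers of r.

The flip is not H-linear, because Δ(y) = y ⊗ g + 1 ⊗ y is not symmetric. It is corrected to 1 ⊗ x^s
v ↦ x^s v ⊗ 1 + α_s x^(s-1) v ⊗ x and x ⊗ x^(s-1) v ↦ β_s x^(s-1) g⁻¹v ⊗ x; commuting with y is a
recursion for α and β (`swapAlpha_succ`).

In M(V,j) ⊗ M(1,2) one has y^s(a ⊗ 1) = x^s a ⊗ 1 + [s] x^(s-1) a ⊗ x. For j < n the vector y^j(a ⊗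
1) = [j] x^(j-1) a ⊗ x is nonzero when a is, so the a ⊗ 1 generate a copy of M(V,j+1); a complement
is generated by xc ⊗ 1 + b c ⊗ x, with b chosen so that y^(j-1) kills it (`lowMap`). For j = n, [n]
= 0 cuts the first copy down to M(V,n), and the c ⊗ x generate the second (`topEquiv`). In both
cases the extra x multiplies the G-action by χ⁻¹, which is the source of τ. -/

namespace RankOne

namespace GroupDatum

variable {k : Type u} {G : Type v} [Field k] [Group G]

/-- A `k`-linear equivalence commuting with `y` and with the elements of `G` is `H_D`-linear. -/
theorem nonempty_linearEquiv (D : GroupDatum k G) {M N : Type*} [AddCommGroup M] [AddCommGroup N]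
    [Module k M] [Module k N] [Module D.H M] [Module D.H N] [IsScalarTower k D.H M]
    [IsScalarTower k D.H N] (e : M ≃ₗ[k] N) (hy : ∀ a, e (D.y • a) = D.y • e a)
    (hg : ∀ h a, e (D.gr h • a) = D.gr h • e a) : Nonempty (M ≃ₗ[D.H] N) := by
  -- The action on N and the conjugate by `e` of the action on M are two algebra maps from H to
  -- End(N); they need only agree on generators.
  have key : (Algebra.lsmul k k N : D.H →ₐ[k] Module.End k N) =
      (e.conjAlgEquiv k).toAlgHom.comp (Algebra.lsmul k k M) := by
    apply hom_ext
    · ext a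
      simp [LinearEquiv.conjAlgEquiv_apply, hy]
    · intro h
      ext a
      simp [LinearEquiv.conjAlgEquiv_apply, hg]
  refine ⟨{ e with map_smul' := fun c a => ?_ }⟩
  have := LinearMap.congr_fun (DFunLike.congr_fun key c) (e a)
  simpa [LinearEquiv.conjAlgEquiv_apply] using this.symm

/-! ### Coefficients, and the modules M(V, j) in coordinates -/

section coeff

variable (k) {V : Type w} [AddCommGroup V] [Module k V]

/-- The `l`-th coefficient of an element of `V ⊕ x V ⊕ ⋯ ⊕ x ^ (j - 1) V`, zero for `j ≤ l`. -/
def coeff (j l : ℕ) : (Fin j → V) →ₗ[k] V :=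
  if h : l < j then LinearMap.proj ⟨l, h⟩ else 0

variable {k}

theorem coeff_of_lt {j l : ℕ} (h : l < j) (f : Fin j → V) : coeff k j l f = f ⟨l, h⟩ := by
  simp [coeff, h]

theorem coeff_of_le {j l : ℕ} (h : j ≤ l) (f : Fin j → V) : coeff k j l f = 0 := by
  simp [coeff, not_lt.mpr h]

@[simp] theorem coeff_fin {j : ℕ} (l : Fin j) (f : Fin j → V) : coeff k j l.1 f = f l :=
  coeff_of_lt l.2 f

theorem shift_apply_of_eq_zero {j : ℕ} (f : Fin j → V) (l : Fin j) (hl : l.1 = 0) :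
    shift k V j f l = 0 := by
  simp [shift, hl]

theorem shift_apply_of_eq_succ {j : ℕ} (f : Fin j → V) (l : Fin j) {s : ℕ} (hl : l.1 = s + 1) :
    shift k V j f l = coeff k j s f := by
  rw [coeff_of_lt (by omega)]
  simp [shift, hl]

@[simp] theorem coeff_zero_shift {j : ℕ} (f : Fin j → V) : coeff k j 0 (shift k V j f) = 0 := by
  by_cases h : 0 < j
  · rw [coeff_of_lt h, shift_apply_of_eq_zero _ _ rfl]
  · exact coeff_of_le (by omega) _

/-- The bound matters: for s + 1 = j the left side is 0 while the right side is the top coefficient.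
This boundary case is handled separately below, by the vanishing of a scalar. -/
theorem coeff_succ_shift {j s : ℕ} (h : s + 1 < j) (f : Fin j → V) :
    coeff k j (s + 1) (shift k V j f) = coeff k j s f := by
  rw [coeff_of_lt h, shift_apply_of_eq_succ _ _ rfl]

theorem coeff_grAct (D : GroupDatum k G) (ρ : Representation k G V) (h : G) (j l : ℕ)
    (f : Fin j → V) :
    coeff k j l (D.grAct ρ j h f) = ((D.χ h : k)⁻¹) ^ l • ρ h (coeff k j l f) := by
  by_cases hl : l < j
  · simp [coeff_of_lt hl, grAct]
  · simp [coeff_of_le (not_lt.mp hl)]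

theorem grAct_apply (D : GroupDatum k G) (ρ : Representation k G V) (h : G) {j : ℕ} (l : Fin j)
    (f : Fin j → V) : D.grAct ρ j h f l = ((D.χ h : k)⁻¹) ^ l.1 • ρ h (f l) := by
  simp [grAct]

variable {D : GroupDatum k G} (ρ : Representation k G V) (hD : D.IsNilpotentType) {j : ℕ}
  (hj : j ≤ D.n)

/-- The coordinates of an element of `M(V, j)`. -/
def Mod.coords : Mod hD ρ j hj ≃ₗ[k] (Fin j → V) := LinearEquiv.refl k (Fin j → V)

theorem Mod.coords_y_smul (f : Mod hD ρ j hj) :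
    coords ρ hD hj (D.y • f) = shift k V j (coords ρ hD hj f) :=
  LinearMap.congr_fun (lift_y D _ _ _ _ : modAct ρ hD j hj D.y = _) f

theorem Mod.coords_gr_smul (h : G) (f : Mod hD ρ j hj) :
    coords ρ hD hj (D.gr h • f) = D.grAct ρ j h (coords ρ hD hj f) :=
  LinearMap.congr_fun (lift_gr D _ _ _ _ h : modAct ρ hD j hj (D.gr h) = _) f

/-- Isomorphic representations give isomorphic modules. -/
theorem Mod.nonempty_congr {W : Type*} [AddCommGroup W] [Module k W] {σ : Representation k G W}
    (e : ρ.Equiv σ) : Nonempty (Mod hD ρ j hj ≃ₗ[D.H] Mod hD σ j hj) := by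
  let E : (Fin j → V) ≃ₗ[k] (Fin j → W) :=
    LinearEquiv.piCongrRight fun _ : Fin j => e.toLinearEquiv
  have hE : ∀ f l, E f l = e.toLinearEquiv (f l) := fun _ _ => rfl
  refine D.nonempty_linearEquiv (coords ρ hD hj ≪≫ₗ E ≪≫ₗ (coords σ hD hj).symm)
    (fun f => ?_) fun h f => ?_
  · apply (coords σ hD hj).injective
    simp only [LinearEquiv.trans_apply, LinearEquiv.apply_symm_apply, coords_y_smul]
    funext l
    rcases hl : l.1 with _ | s
    · rw [hE, shift_apply_of_eq_zero _ _ hl, shift_apply_of_eq_zero _ _ hl, map_zero]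
    · rw [hE, shift_apply_of_eq_succ _ _ hl, shift_apply_of_eq_succ _ _ hl,
        coeff_of_lt (by omega), coeff_of_lt (by omega), hE]
  · apply (coords σ hD hj).injective
    simp only [LinearEquiv.trans_apply, LinearEquiv.apply_symm_apply, coords_gr_smul]
    funext l
    rw [hE, grAct_apply, grAct_apply, map_smul, hE]
    congr 1
    exact LinearMap.congr_fun (e.toIntertwiningMap.isIntertwining' h) _

end coeff

/-! ### Coordinates on the tensor products with `M(1, 2)` -/

section coordinates

variable {V : Type w} [AddCommGroup V] [Module k V] (D : GroupDatum k G)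
  (ρ : Representation k G V) (j : ℕ)

/-- The action of `y` on `M(V, j) ⊗ M(1, 2)`, where `(f₀, f₁)` stands for `f₀ ⊗ 1 + f₁ ⊗ x`. -/
def yRight : Module.End k ((Fin j → V) × (Fin j → V)) :=
  (shift k V j ∘ₗ LinearMap.fst k _ _).prod
    (LinearMap.fst k _ _ + (D.χ D.g : k)⁻¹ • shift k V j ∘ₗ LinearMap.snd k _ _)

/-- The action of `y` on `M(1, 2) ⊗ M(V, j)`, where `(f₀, f₁)` stands for `1 ⊗ f₀ + x ⊗ f₁`. -/
noncomputable def yLeft : Module.End k ((Fin j → V) × (Fin j → V)) :=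
  (shift k V j ∘ₗ LinearMap.fst k _ _).prod
    (D.grAct ρ j D.g ∘ₗ LinearMap.fst k _ _ + shift k V j ∘ₗ LinearMap.snd k _ _)

/-- The action of `h ∈ G` on both tensor products. -/
noncomputable def grPair (h : G) : Module.End k ((Fin j → V) × (Fin j → V)) :=
  (D.grAct ρ j h).prodMap ((D.χ h : k)⁻¹ • D.grAct ρ j h)

theorem yRight_apply (p : (Fin j → V) × (Fin j → V)) :
    D.yRight j p = (shift k V j p.1, p.1 + (D.χ D.g : k)⁻¹ • shift k V j p.2) := rfl

theorem yLeft_apply (p : (Fin j → V) × (Fin j → V)) :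
    D.yLeft ρ j p = (shift k V j p.1, D.grAct ρ j D.g p.1 + shift k V j p.2) := rfl

theorem grPair_apply (h : G) (p : (Fin j → V) × (Fin j → V)) :
    D.grPair ρ j h p = (D.grAct ρ j h p.1, (D.χ h : k)⁻¹ • D.grAct ρ j h p.2) := rfl

variable {U : Type*} [AddCommGroup U] [Module k U] {D} {j} (hD : D.IsNilpotentType)
  (hj : j ≤ D.n) (hn : 2 ≤ D.n) {π : Representation k G U}
  (e : π.Equiv (Representation.trivial k G k))

/-- `M(V, j) ⊗ M(U, 2)` in coordinates, for `U` trivial and one-dimensional. -/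
noncomputable def rightCoords :
    Mod hD ρ j hj ⊗[k] Mod hD π 2 hn ≃ₗ[k] (Fin j → V) × (Fin j → V) :=
  TensorProduct.congr (Mod.coords ρ hD hj)
      (Mod.coords π hD hn ≪≫ₗ LinearEquiv.piCongrRight fun _ => e.toLinearEquiv) ≪≫ₗ
    TensorProduct.piScalarRight k k (Fin j → V) (Fin 2) ≪≫ₗ LinearEquiv.finTwoArrow k _

/-- `M(U, 2) ⊗ M(V, j)` in coordinates, for `U` trivial and one-dimensional. -/
noncomputable def leftCoords :
    Mod hD π 2 hn ⊗[k] Mod hD ρ j hj ≃ₗ[k] (Fin j → V) × (Fin j → V) :=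
  TensorProduct.comm k _ _ ≪≫ₗ rightCoords ρ hD hj hn e

theorem rightCoords_tmul (f : Mod hD ρ j hj) (a : Mod hD π 2 hn) :
    rightCoords ρ hD hj hn e (f ⊗ₜ a) =
      (e.toLinearEquiv (Mod.coords π hD hn a 0) • Mod.coords ρ hD hj f,
        e.toLinearEquiv (Mod.coords π hD hn a 1) • Mod.coords ρ hD hj f) := by
  simp [rightCoords]

theorem leftCoords_tmul (f : Mod hD ρ j hj) (a : Mod hD π 2 hn) :
    leftCoords ρ hD hj hn e (a ⊗ₜ f) =
      (e.toLinearEquiv (Mod.coords π hD hn a 0) • Mod.coords ρ hD hj f,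
        e.toLinearEquiv (Mod.coords π hD hn a 1) • Mod.coords ρ hD hj f) := by
  simp [leftCoords, rightCoords_tmul]

theorem trivial_equiv_apply (h : G) (a : U) : e.toLinearEquiv (π h a) = e.toLinearEquiv a :=
  LinearMap.congr_fun (e.toIntertwiningMap.isIntertwining' h) a

theorem shift_two_zero (a : Fin 2 → U) : shift k U 2 a 0 = 0 :=
  shift_apply_of_eq_zero _ _ rfl

theorem shift_two_one (a : Fin 2 → U) : shift k U 2 a 1 = a 0 :=
  (shift_apply_of_eq_succ _ _ (s := 0) rfl).trans (coeff_of_lt (by omega) _)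

variable [Finite G]

/-- In y ⊗ g + 1 ⊗ y the element g acts on 1 and x of M(U,2) by 1 and χ(g)⁻¹, and 1 ⊗ y moves f ⊗ 1
to f ⊗ x. -/
theorem rightCoords_act_y (t : Mod hD ρ j hj ⊗[k] Mod hD π 2 hn) :
    rightCoords ρ hD hj hn e (HTensor.act k D.H _ _ D.y t) =
      D.yRight j (rightCoords ρ hD hj hn e t) := by
  induction t using TensorProduct.induction_on with
  | zero => simp
  | add x y hx hy => simp [hx, hy]
  | tmul f a =>
    simp [tensorAct_y, rightCoords_tmul, yRight_apply, Mod.coords_y_smul, Mod.coords_gr_smul,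
      grAct_apply, trivial_equiv_apply, shift_two_zero, shift_two_one, smul_smul, add_comm]

/-- Here g falls on M(V,j), whence the term `grAct` at g; y kills x, so the second shift carries no
scalar. -/
theorem leftCoords_act_y (t : Mod hD π 2 hn ⊗[k] Mod hD ρ j hj) :
    leftCoords ρ hD hj hn e (HTensor.act k D.H _ _ D.y t) =
      D.yLeft ρ j (leftCoords ρ hD hj hn e t) := by
  induction t using TensorProduct.induction_on with
  | zero => simp
  | add x y hx hy => simp [hx, hy]
  | tmul a f =>
    simp [tensorAct_y, leftCoords_tmul, yLeft_apply, Mod.coords_y_smul, Mod.coords_gr_smul,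
      shift_two_zero, shift_two_one]

theorem rightCoords_act_gr (h : G) (t : Mod hD ρ j hj ⊗[k] Mod hD π 2 hn) :
    rightCoords ρ hD hj hn e (HTensor.act k D.H _ _ (D.gr h) t) =
      D.grPair ρ j h (rightCoords ρ hD hj hn e t) := by
  induction t using TensorProduct.induction_on with
  | zero => simp
  | add x y hx hy => simp [hx, hy]
  | tmul f a =>
    simp [tensorAct_gr, rightCoords_tmul, grPair_apply, Mod.coords_gr_smul, grAct_apply,
      trivial_equiv_apply, smul_smul]

theorem leftCoords_act_gr (h : G) (t : Mod hD π 2 hn ⊗[k] Mod hD ρ j hj) :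
    leftCoords ρ hD hj hn e (HTensor.act k D.H _ _ (D.gr h) t) =
      D.grPair ρ j h (leftCoords ρ hD hj hn e t) := by
  induction t using TensorProduct.induction_on with
  | zero => simp
  | add x y hx hy => simp [hx, hy]
  | tmul a f =>
    simp [tensorAct_gr, leftCoords_tmul, grPair_apply, Mod.coords_gr_smul, grAct_apply,
      trivial_equiv_apply, smul_smul]

/-- An equivalence of coordinate spaces compatible with the actions gives an isomorphism
`M(U, 2) ⊗ M(V, j) ≅ M(V, j) ⊗ M(U, 2)`. -/
theorem nonempty_left_equiv_right (e : π.Equiv (Representation.trivial k G k))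
    (θ : ((Fin j → V) × (Fin j → V)) ≃ₗ[k] (Fin j → V) × (Fin j → V))
    (hy : ∀ p, θ (D.yLeft ρ j p) = D.yRight j (θ p))
    (hg : ∀ h p, θ (D.grPair ρ j h p) = D.grPair ρ j h (θ p)) :
    Nonempty (HTensor k D.H (Mod hD π 2 hn) (Mod hD ρ j hj) ≃ₗ[D.H]
      HTensor k D.H (Mod hD ρ j hj) (Mod hD π 2 hn)) := by
  let E : HTensor k D.H (Mod hD π 2 hn) (Mod hD ρ j hj) ≃ₗ[k]
      HTensor k D.H (Mod hD ρ j hj) (Mod hD π 2 hn) :=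
    leftCoords ρ hD hj hn e ≪≫ₗ θ ≪≫ₗ (rightCoords ρ hD hj hn e).symm
  have hE : ∀ t, rightCoords ρ hD hj hn e (E t) = θ (leftCoords ρ hD hj hn e t) :=
    fun t => (rightCoords ρ hD hj hn e).apply_symm_apply _
  refine D.nonempty_linearEquiv E (fun t => ?_) fun h t => ?_
  · apply (rightCoords ρ hD hj hn e).injective
    refine (hE _).trans ?_
    refine (congrArg θ (leftCoords_act_y ρ hD hj hn e t)).trans ((hy _).trans ?_)
    exact ((rightCoords_act_y ρ hD hj hn e (E t)).trans (congrArg _ (hE t))).symm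
  · apply (rightCoords ρ hD hj hn e).injective
    refine (hE _).trans ?_
    refine (congrArg θ (leftCoords_act_gr ρ hD hj hn e h t)).trans ((hg _ _).trans ?_)
    exact ((rightCoords_act_gr ρ hD hj hn e h (E t)).trans (congrArg _ (hE t))).symm

/-- A decomposition of the coordinate space compatible with the actions gives a decomposition
of `M(V, j) ⊗ M(U, 2)`. -/
theorem nonempty_right_equiv_prod {W : Type*} [AddCommGroup W] [Module k W]
    (σ : Representation k G W) (e : π.Equiv (Representation.trivial k G k))
    {a b : ℕ} (ha : a ≤ D.n) (hb : b ≤ D.n)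
    (Φ : ((Fin a → V) × (Fin b → W)) ≃ₗ[k] (Fin j → V) × (Fin j → V))
    (hy : ∀ p, Φ (shift k V a p.1, shift k W b p.2) = D.yRight j (Φ p))
    (hg : ∀ h p, Φ (D.grAct ρ a h p.1, D.grAct σ b h p.2) = D.grPair ρ j h (Φ p)) :
    Nonempty (HTensor k D.H (Mod hD ρ j hj) (Mod hD π 2 hn) ≃ₗ[D.H]
      Mod hD ρ a ha × Mod hD σ b hb) := by
  let C : (Mod hD ρ a ha × Mod hD σ b hb) ≃ₗ[k] (Fin a → V) × (Fin b → W) :=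
    (Mod.coords ρ hD ha).prodCongr (Mod.coords σ hD hb)
  -- The map starts from the direct sum, where it is determined by the images of generators; it is
  -- inverted at the end.
  let E : (Mod hD ρ a ha × Mod hD σ b hb) ≃ₗ[k]
      HTensor k D.H (Mod hD ρ j hj) (Mod hD π 2 hn) :=
    C ≪≫ₗ Φ ≪≫ₗ (rightCoords ρ hD hj hn e).symm
  have hE : ∀ t, rightCoords ρ hD hj hn e (E t) = Φ (C t) :=
    fun t => (rightCoords ρ hD hj hn e).apply_symm_apply _
  have hCy : ∀ t, C (D.y • t) = (shift k V a (C t).1, shift k W b (C t).2) := fun t =>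
    Prod.ext (Mod.coords_y_smul ρ hD ha t.1) (Mod.coords_y_smul σ hD hb t.2)
  have hCg : ∀ h t, C (D.gr h • t) = (D.grAct ρ a h (C t).1, D.grAct σ b h (C t).2) := fun h t =>
    Prod.ext (Mod.coords_gr_smul ρ hD ha h t.1) (Mod.coords_gr_smul σ hD hb h t.2)
  refine (D.nonempty_linearEquiv E (fun t => ?_) fun h t => ?_).map LinearEquiv.symm
  · apply (rightCoords ρ hD hj hn e).injective
    rw [hE, hCy, hy]
    exact ((rightCoords_act_y ρ hD hj hn e (E t)).trans (congrArg _ (hE t))).symm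
  · apply (rightCoords ρ hD hj hn e).injective
    rw [hE, hCg, hg]
    exact ((rightCoords_act_gr ρ hD hj hn e h (E t)).trans (congrArg _ (hE t))).symm

end coordinates

end GroupDatum

end RankOne

/-! ### q-integers at a root of unity -/

namespace RankOne

/-- The `q`-integer `1 + r + ⋯ + r ^ (s - 1)`. -/
def qInt {k : Type u} [Field k] (r : k) (s : ℕ) : k := ∑ t ∈ Finset.range s, r ^ t

section qInt

variable {k : Type u} [Field k] (r : k)

@[simp] theorem qInt_zero : qInt r 0 = 0 := by simp [qInt]

@[simp] theorem qInt_one : qInt r 1 = 1 := by simp [qInt]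

theorem qInt_succ (s : ℕ) : qInt r (s + 1) = qInt r s + r ^ s := Finset.sum_range_succ _ _

/-- This form of the recursion is the one produced by y: each step multiplies the old coefficient by
r and adds 1. -/
theorem qInt_succ' (s : ℕ) : qInt r (s + 1) = 1 + r * qInt r s := by
  rw [qInt, geom_sum_succ, add_comm, qInt]

variable {r}

theorem qInt_eq_zero {n : ℕ} (hr : IsPrimitiveRoot r n) (hn : 2 ≤ n) : qInt r n = 0 :=
  hr.geom_sum_eq_zero (by omega)

/-- From (r - 1)[s] = r^s - 1. -/
theorem qInt_ne_zero {n s : ℕ} (hr : IsPrimitiveRoot r n) (h0 : 0 < s) (hs : s < n) :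
    qInt r s ≠ 0 := by
  intro h
  have h1 := mul_geom_sum r s
  rw [qInt] at h
  rw [h, mul_zero] at h1
  exact hr.pow_ne_one_of_pos_of_lt h0.ne' hs (sub_eq_zero.mp h1.symm)

end qInt

namespace GroupDatum

variable {k : Type u} {G : Type v} [Field k] [Group G] (D : GroupDatum k G)

theorem isPrimitiveRoot_inv [Finite G] : IsPrimitiveRoot ((D.χ D.g : k)⁻¹) D.n :=
  D.isPrimitiveRoot.inv

theorem inv_χ_ne_zero (h : G) : (D.χ h : k)⁻¹ ≠ 0 := inv_ne_zero (Units.ne_zero _)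

/-! ### Exchanging the two tensor factors -/

section

variable {V : Type w} [AddCommGroup V] [Module k V] (ρ : Representation k G V)

/-- Centrality of g lets the twist by g⁻¹ in the exchange map commute with G. -/
theorem ρ_g_inv_comm (h : G) (v : V) : ρ D.g⁻¹ (ρ h v) = ρ h (ρ D.g⁻¹ v) := by
  have hc : D.g⁻¹ * h = h * D.g⁻¹ :=
    (Subgroup.mem_center_iff.mp (inv_mem D.g_central) h).symm
  rw [← Module.End.mul_apply, ← map_mul, hc, map_mul, Module.End.mul_apply]

/-- `β s = r ^ (s - j)` for `r = χ(g)⁻¹`. -/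
noncomputable def swapBeta (j s : ℕ) : k := (D.χ D.g : k)⁻¹ ^ s * ((D.χ D.g : k)⁻¹ ^ j)⁻¹

theorem swapBeta_ne_zero (j s : ℕ) : D.swapBeta j s ≠ 0 :=
  mul_ne_zero (pow_ne_zero _ (D.inv_χ_ne_zero _)) (inv_ne_zero (pow_ne_zero _ (D.inv_χ_ne_zero _)))

theorem swapBeta_self (j : ℕ) : D.swapBeta j j = 1 :=
  mul_inv_cancel₀ (pow_ne_zero _ (D.inv_χ_ne_zero _))

theorem swapBeta_succ (j s : ℕ) :
    D.swapBeta j (s + 1) = (D.χ D.g : k)⁻¹ * D.swapBeta j s := by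
  rw [swapBeta, swapBeta, pow_succ', mul_assoc]

/-- `α s = [s] (1 - β s)`. -/
noncomputable def swapAlpha (j s : ℕ) : k :=
  qInt (D.χ D.g : k)⁻¹ s * (1 - D.swapBeta j s)

/-- Forced by x^j v = 0: nothing may be left of the image of 1 ⊗ x^j v. The normalisation β_j = 1
achieves it. -/
theorem swapAlpha_self (j : ℕ) : D.swapAlpha j j = 0 := by
  simp [swapAlpha, swapBeta_self]

/-- Both sides are the coefficient of x^s v ⊗ x after applying y and the exchange map to 1 ⊗ x^s v,
in the two orders. -/
theorem swapAlpha_succ (j s : ℕ) :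
    D.swapAlpha j (s + 1) + D.swapBeta j (s + 1) * (D.χ D.g : k)⁻¹ ^ s =
      1 + (D.χ D.g : k)⁻¹ * D.swapAlpha j s := by
  have h := (qInt_succ (D.χ D.g : k)⁻¹ s).symm.trans (qInt_succ' _ s)
  rw [swapAlpha, swapAlpha, qInt_succ', swapBeta_succ]
  linear_combination (D.χ D.g : k)⁻¹ * D.swapBeta j s * h

theorem swapAlpha_zero (j : ℕ) : D.swapAlpha j 0 = 0 := by simp [swapAlpha]

/-- The isomorphism `M(1, 2) ⊗ M(V, j) ≅ M(V, j) ⊗ M(1, 2)` in coordinates: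
`1 ⊗ x ^ s v ↦ x ^ s v ⊗ 1 + α s x ^ (s - 1) v ⊗ x` and
`x ⊗ x ^ (s - 1) v ↦ β s x ^ (s - 1) (g⁻¹ v) ⊗ x`. -/
noncomputable def swapEquiv (j : ℕ) :
    ((Fin j → V) × (Fin j → V)) ≃ₗ[k] (Fin j → V) × (Fin j → V) where
  toFun p := (p.1, fun l => D.swapAlpha j (l.1 + 1) • coeff k j (l.1 + 1) p.1 +
    D.swapBeta j (l.1 + 1) • ρ D.g⁻¹ (p.2 l))
  invFun p := (p.1, fun l => (D.swapBeta j (l.1 + 1))⁻¹ •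
    ρ D.g (p.2 l - D.swapAlpha j (l.1 + 1) • coeff k j (l.1 + 1) p.1))
  map_add' p p' := by
    refine Prod.ext rfl (funext fun l => ?_)
    simp only [Prod.fst_add, Prod.snd_add, map_add, Pi.add_apply, smul_add]
    abel
  map_smul' c p := by
    refine Prod.ext rfl (funext fun l => ?_)
    simp [smul_comm c]
  left_inv p := by
    refine Prod.ext rfl (funext fun l => ?_)
    simp [smul_smul, inv_mul_cancel₀ (D.swapBeta_ne_zero _ _)]
  right_inv p := by
    refine Prod.ext rfl (funext fun l => ?_)
    simp only [map_smul, smul_smul, mul_inv_cancel₀ (D.swapBeta_ne_zero _ _)]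
    simp

theorem swapEquiv_yLeft (j : ℕ) (p : (Fin j → V) × (Fin j → V)) :
    D.swapEquiv ρ j (D.yLeft ρ j p) = D.yRight j (D.swapEquiv ρ j p) := by
  refine Prod.ext rfl (funext fun l => ?_)
  have hl := l.2
  -- At l + 1 = j the shift is cut off, and equality holds because α_j = 0.
  have h1 : D.swapAlpha j (l.1 + 1) • coeff k j (l.1 + 1) (shift k V j p.1) =
      D.swapAlpha j (l.1 + 1) • p.1 l := by
    by_cases h : l.1 + 1 < j
    · rw [coeff_succ_shift h, coeff_fin]
    · rw [show l.1 + 1 = j by omega, swapAlpha_self, zero_smul, zero_smul]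
  -- The g coming from Δ(y) cancels the g⁻¹ of the exchange map, leaving only r^l.
  have h2 : D.swapBeta j (l.1 + 1) • ρ D.g⁻¹ (D.grAct ρ j D.g p.1 l) =
      (D.swapBeta j (l.1 + 1) * (D.χ D.g : k)⁻¹ ^ l.1) • p.1 l := by
    rw [grAct_apply, map_smul, smul_smul]
    simp
  change D.swapAlpha j (l.1 + 1) • coeff k j (l.1 + 1) (shift k V j p.1) +
    D.swapBeta j (l.1 + 1) • ρ D.g⁻¹ (D.grAct ρ j D.g p.1 l + shift k V j p.2 l) =
    p.1 l + (D.χ D.g : k)⁻¹ • shift k V j (D.swapEquiv ρ j p).2 l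
  rw [map_add, smul_add, h1, h2, ← add_assoc, ← add_smul, swapAlpha_succ]
  rcases h : l.1 with _ | s
  · rw [shift_apply_of_eq_zero _ _ h, shift_apply_of_eq_zero _ _ h, swapAlpha_zero]
    simp
  · rw [shift_apply_of_eq_succ _ _ h, shift_apply_of_eq_succ _ _ h, coeff_of_lt (by omega),
      coeff_of_lt (by omega), swapBeta_succ]
    simp only [swapEquiv, LinearEquiv.coe_mk, LinearMap.coe_mk, AddHom.coe_mk]
    have : p.1 l = coeff k j (s + 1) p.1 := by rw [← h, coeff_fin]
    rw [this]
    module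

/-- The vectors x^s v ⊗ 1 and x^(s-1) v ⊗ x carry the same power χ^(-s), so mixing them respects G.
-/
theorem swapEquiv_grPair (j : ℕ) (h : G) (p : (Fin j → V) × (Fin j → V)) :
    D.swapEquiv ρ j (D.grPair ρ j h p) = D.grPair ρ j h (D.swapEquiv ρ j p) := by
  refine Prod.ext rfl (funext fun l => ?_)
  simp only [grPair_apply, swapEquiv, LinearEquiv.coe_mk, LinearMap.coe_mk, AddHom.coe_mk,
    coeff_grAct, Pi.smul_apply, grAct_apply, map_smul, map_add, ρ_g_inv_comm]
  module

/-! ### The decompositions -/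

theorem grAct_twist (j : ℕ) (h : G) (c : Fin j → V) :
    D.grAct (twist D.χ⁻¹ ρ) j h c = (D.χ h : k)⁻¹ • D.grAct ρ j h c := by
  funext l
  rw [Pi.smul_apply, grAct_apply, grAct_apply, smul_comm]
  simp [twist]

/-- The decomposition of `M(V, n) ⊗ M(1, 2)` in coordinates: `x ^ s a ↦ y ^ s (a ⊗ 1)` and
`x ^ s c ↦ y ^ s (c ⊗ x)`. -/
noncomputable def topEquiv (j : ℕ) :
    ((Fin j → V) × (Fin j → V)) ≃ₗ[k] (Fin j → V) × (Fin j → V) where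
  -- The coefficient of x^l ⊗ x in y^s(a ⊗ 1) comes from s = l + 1, that in y^s(c ⊗ x) from s = l.
  toFun p := (p.1, fun l => qInt (D.χ D.g : k)⁻¹ (l.1 + 1) • coeff k j (l.1 + 1) p.1 +
    (D.χ D.g : k)⁻¹ ^ l.1 • p.2 l)
  invFun p := (p.1, fun l => ((D.χ D.g : k)⁻¹ ^ l.1)⁻¹ •
    (p.2 l - qInt (D.χ D.g : k)⁻¹ (l.1 + 1) • coeff k j (l.1 + 1) p.1))
  map_add' p p' := by
    refine Prod.ext rfl (funext fun l => ?_)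
    simp only [Prod.fst_add, Prod.snd_add, map_add, Pi.add_apply, smul_add]
    abel
  map_smul' c p := by
    refine Prod.ext rfl (funext fun l => ?_)
    simp [smul_comm c]
  left_inv p := by
    refine Prod.ext rfl (funext fun l => ?_)
    simp [smul_smul]
  right_inv p := by
    refine Prod.ext rfl (funext fun l => ?_)
    simp [smul_smul]

theorem topEquiv_y {j : ℕ} (hj : qInt (D.χ D.g : k)⁻¹ j = 0) (p : (Fin j → V) × (Fin j → V)) :
    D.topEquiv j (shift k V j p.1, shift k V j p.2) = D.yRight j (D.topEquiv j p) := by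
  refine Prod.ext rfl (funext fun l => ?_)
  have hl := l.2
  -- At l + 1 = j this is the relation y^j(a ⊗ 1) = [j] x^(j-1) a ⊗ x = 0.
  have h1 : qInt (D.χ D.g : k)⁻¹ (l.1 + 1) • coeff k j (l.1 + 1) (shift k V j p.1) =
      qInt (D.χ D.g : k)⁻¹ (l.1 + 1) • p.1 l := by
    by_cases h : l.1 + 1 < j
    · rw [coeff_succ_shift h, coeff_fin]
    · rw [show l.1 + 1 = j by omega, hj, zero_smul, zero_smul]
  change qInt (D.χ D.g : k)⁻¹ (l.1 + 1) • coeff k j (l.1 + 1) (shift k V j p.1) +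
    (D.χ D.g : k)⁻¹ ^ l.1 • shift k V j p.2 l =
    p.1 l + (D.χ D.g : k)⁻¹ • shift k V j (D.topEquiv j p).2 l
  rw [h1]
  rcases h : l.1 with _ | s
  · rw [shift_apply_of_eq_zero _ _ h, shift_apply_of_eq_zero _ _ h]
    simp
  · rw [shift_apply_of_eq_succ _ _ h, shift_apply_of_eq_succ _ _ h, coeff_of_lt (by omega),
      coeff_of_lt (by omega), qInt_succ']
    simp only [topEquiv, LinearEquiv.coe_mk, LinearMap.coe_mk, AddHom.coe_mk]
    have : p.1 l = coeff k j (s + 1) p.1 := by rw [← h, coeff_fin]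
    rw [this, pow_succ']
    module

theorem topEquiv_gr (j : ℕ) (h : G) (p : (Fin j → V) × (Fin j → V)) :
    D.topEquiv j (D.grAct ρ j h p.1, D.grAct (twist D.χ⁻¹ ρ) j h p.2) =
      D.grPair ρ j h (D.topEquiv j p) := by
  refine Prod.ext rfl (funext fun l => ?_)
  simp only [grPair_apply, topEquiv, LinearEquiv.coe_mk, LinearMap.coe_mk, AddHom.coe_mk,
    coeff_grAct, Pi.smul_apply, grAct_apply, grAct_twist, map_smul, map_add]
  module

/-- The coefficient `d l` of `x ^ l c ⊗ x` in `y ^ l (x c ⊗ 1 + b c ⊗ x)`, where `b` is chosen so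
that `d p = 0`. -/
noncomputable def lowCoeff (p l : ℕ) : k :=
  qInt (D.χ D.g : k)⁻¹ l -
    qInt (D.χ D.g : k)⁻¹ p * ((D.χ D.g : k)⁻¹ ^ p)⁻¹ * (D.χ D.g : k)⁻¹ ^ l

/-- With b = -[p] r^(-p) and x^(p+1) = 0, this says that y^p kills the second generator. -/
theorem lowCoeff_self (p : ℕ) : D.lowCoeff p p = 0 := by
  rw [lowCoeff, mul_assoc, inv_mul_cancel₀ (pow_ne_zero _ (D.inv_χ_ne_zero _)), mul_one, sub_self]

theorem lowCoeff_succ (p l : ℕ) :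
    D.lowCoeff p (l + 1) = 1 + (D.χ D.g : k)⁻¹ * D.lowCoeff p l := by
  rw [lowCoeff, lowCoeff, qInt_succ', pow_succ']
  ring

/-- This is the determinant of the 2 × 2 block expressing y^(l+1)(a ⊗ 1) and y^l(xc ⊗ 1 + b c ⊗ x)
through x^(l+1) ⊗ 1 and x^l ⊗ x; it equals -r^(l-p)[p+1]. -/
theorem lowCoeff_sub_ne_zero {p : ℕ} (hp : qInt (D.χ D.g : k)⁻¹ (p + 1) ≠ 0) (l : ℕ) :
    D.lowCoeff p l - qInt (D.χ D.g : k)⁻¹ (l + 1) ≠ 0 := by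
  have hr := D.inv_χ_ne_zero D.g
  have : D.lowCoeff p l - qInt (D.χ D.g : k)⁻¹ (l + 1) =
      -((D.χ D.g : k)⁻¹ ^ l * ((D.χ D.g : k)⁻¹ ^ p)⁻¹ * qInt (D.χ D.g : k)⁻¹ (p + 1)) := by
    have h := inv_mul_cancel₀ (pow_ne_zero p hr)
    rw [lowCoeff, qInt_succ, qInt_succ]
    linear_combination (D.χ D.g : k)⁻¹ ^ l * h
  rw [this]
  exact neg_ne_zero.mpr (mul_ne_zero (mul_ne_zero (pow_ne_zero _ hr)
    (inv_ne_zero (pow_ne_zero _ hr))) hp)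

/-- The decomposition of `M(V, p + 1) ⊗ M(1, 2)` in coordinates: `x ^ s a ↦ y ^ s (a ⊗ 1)` and
`x ^ s c ↦ y ^ s (x c ⊗ 1 + b c ⊗ x)`. -/
noncomputable def lowMap (p : ℕ) :
    ((Fin (p + 2) → V) × (Fin p → V)) →ₗ[k] (Fin (p + 1) → V) × (Fin (p + 1) → V) where
  -- The top coefficient of `q.1`, at index p + 1, drops out of the first component since x^(p+1) =
  -- 0; it survives in the second with factor [p+1].
  toFun q := ((fun s => coeff k (p + 2) s.1 q.1) + shift k V (p + 1) fun s => coeff k p s.1 q.2,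
    fun l => qInt (D.χ D.g : k)⁻¹ (l.1 + 1) • coeff k (p + 2) (l.1 + 1) q.1 +
      D.lowCoeff p l.1 • coeff k p l.1 q.2)
  map_add' q q' := by
    refine Prod.ext ?_ (funext fun l => ?_)
    · simp only [Prod.fst_add, Prod.snd_add, map_add]
      rw [add_add_add_comm, ← map_add]
      rfl
    · simp only [Prod.fst_add, Prod.snd_add, map_add, Pi.add_apply, smul_add]
      abel
  map_smul' c q := by
    refine Prod.ext ?_ (funext fun l => ?_)
    · simp only [Prod.smul_fst, Prod.smul_snd, map_smul, RingHom.id_apply, smul_add]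
      rw [← map_smul]
      rfl
    · simp [smul_comm c]

theorem lowMap_fst_zero (p : ℕ) (q : (Fin (p + 2) → V) × (Fin p → V)) :
    coeff k (p + 1) 0 (D.lowMap p q).1 = coeff k (p + 2) 0 q.1 := by
  change coeff k (p + 1) 0 (_ + _) = _
  rw [map_add, coeff_zero_shift, add_zero, coeff_of_lt (by omega)]

theorem lowMap_fst_succ {p s : ℕ} (hs : s < p) (q : (Fin (p + 2) → V) × (Fin p → V)) :
    coeff k (p + 1) (s + 1) (D.lowMap p q).1 =
      coeff k (p + 2) (s + 1) q.1 + coeff k p s q.2 := by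
  change coeff k (p + 1) (s + 1) (_ + _) = _
  rw [map_add, coeff_succ_shift (by omega), coeff_of_lt (by omega), coeff_of_lt (by omega)]
  congr 1
  exact coeff_of_lt (by omega) _

theorem lowMap_snd {p l : ℕ} (hl : l < p + 1) (q : (Fin (p + 2) → V) × (Fin p → V)) :
    coeff k (p + 1) l (D.lowMap p q).2 =
      qInt (D.χ D.g : k)⁻¹ (l + 1) • coeff k (p + 2) (l + 1) q.1 +
        D.lowCoeff p l • coeff k p l q.2 :=
  coeff_of_lt hl _

theorem coeff_ext {j : ℕ} {f f' : Fin j → V} (h : ∀ l < j, coeff k j l f = coeff k j l f') :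
    f = f' :=
  funext fun l => by simpa using h l.1 l.2

/-- The map splits by degree: a 1 × 1 block 1 in degree 0, the 2 × 2 blocks in between, and a 1 × 1
block [p+1] on top. -/
theorem lowMap_injective {p : ℕ} (hp : qInt (D.χ D.g : k)⁻¹ (p + 1) ≠ 0) :
    Function.Injective (D.lowMap (V := V) p) := by
  rw [← LinearMap.ker_eq_bot, LinearMap.ker_eq_bot']
  intro q hq
  have h0 := D.lowMap_fst_zero p q
  have h1 := fun s hs => D.lowMap_fst_succ (p := p) (s := s) hs q
  have h2 := fun l hl => D.lowMap_snd (p := p) (l := l) hl q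
  simp only [hq, Prod.fst_zero, Prod.snd_zero, map_zero] at h0 h1 h2
  have hc : ∀ l < p, coeff k p l q.2 = 0 := by
    intro l hl
    have h : (D.lowCoeff p l - qInt (D.χ D.g : k)⁻¹ (l + 1)) • coeff k p l q.2 = 0 := by
      have h3 := h2 l (by omega)
      rw [eq_neg_of_add_eq_zero_left (h1 l hl).symm] at h3
      rw [h3]
      module
    exact (smul_eq_zero.mp h).resolve_left (D.lowCoeff_sub_ne_zero hp l)
  refine Prod.ext (coeff_ext (k := k) fun l hl => ?_) (coeff_ext (k := k) fun l hl => ?_)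
  · rw [Prod.fst_zero, map_zero]
    rcases l with _ | l
    · exact h0.symm
    · rcases Nat.lt_or_ge l p with h | h
      · have := h1 l h
        rw [hc l h, add_zero] at this
        exact this.symm
      · obtain rfl : l = p := by omega
        have := h2 l (by omega)
        rw [lowCoeff_self, zero_smul, add_zero] at this
        exact (smul_eq_zero.mp this.symm).resolve_left hp
  · simpa using hc l hl

theorem lowMap_surjective {p : ℕ} (hp : qInt (D.χ D.g : k)⁻¹ (p + 1) ≠ 0) :
    Function.Surjective (D.lowMap (V := V) p) := by
  intro F
  -- Solution of each 2 × 2 block by elimination; `a` is then read off from the first component,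
  -- except at the top, where [p+1] is inverted.
  let c : ℕ → V := fun l => (D.lowCoeff p l - qInt (D.χ D.g : k)⁻¹ (l + 1))⁻¹ •
    (coeff k (p + 1) l F.2 - qInt (D.χ D.g : k)⁻¹ (l + 1) • coeff k (p + 1) (l + 1) F.1)
  let a : ℕ → V
    | 0 => coeff k (p + 1) 0 F.1
    | s + 1 => if s = p then (qInt (D.χ D.g : k)⁻¹ (p + 1))⁻¹ • coeff k (p + 1) p F.2
        else coeff k (p + 1) (s + 1) F.1 - c s
  have ha : ∀ s < p + 2, coeff k (p + 2) s (fun l : Fin (p + 2) => a l.1) = a s :=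
    fun s hs => coeff_of_lt hs _
  have hc : ∀ s < p, coeff k p s (fun l : Fin p => c l.1) = c s := fun s hs => coeff_of_lt hs _
  refine ⟨(fun l => a l.1, fun l => c l.1),
    Prod.ext (coeff_ext (k := k) fun l hl => ?_) (coeff_ext (k := k) fun l hl => ?_)⟩
  · rcases l with _ | l
    · rw [lowMap_fst_zero, ha _ (by omega)]
    · rw [lowMap_fst_succ _ (by omega), ha _ (by omega), hc _ (by omega)]
      simp [a, show l ≠ p by omega]
  · rw [lowMap_snd _ hl, ha _ (by omega)]
    rcases Nat.lt_or_ge l p with h | h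
    · rw [hc _ h]
      have h3 : (D.lowCoeff p l - qInt (D.χ D.g : k)⁻¹ (l + 1)) • c l = coeff k (p + 1) l F.2 -
          qInt (D.χ D.g : k)⁻¹ (l + 1) • coeff k (p + 1) (l + 1) F.1 :=
        smul_inv_smul₀ (D.lowCoeff_sub_ne_zero hp l) _
      have h4 : a (l + 1) = coeff k (p + 1) (l + 1) F.1 - c l := by simp [a, h.ne]
      rw [h4, ← sub_eq_zero, ← sub_eq_zero.mpr h3]
      module
    · obtain rfl : l = p := by omega
      rw [lowCoeff_self, zero_smul, add_zero]
      simp [a, smul_smul, hp]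

theorem lowMap_y (p : ℕ) (q : (Fin (p + 2) → V) × (Fin p → V)) :
    D.lowMap p (shift k V (p + 2) q.1, shift k V p q.2) = D.yRight (p + 1) (D.lowMap p q) := by
  refine Prod.ext (coeff_ext (k := k) fun l hl => ?_) (coeff_ext (k := k) fun l hl => ?_)
  · rw [yRight_apply]
    rcases l with _ | l
    · rw [lowMap_fst_zero, coeff_zero_shift, coeff_zero_shift]
    · rw [lowMap_fst_succ _ (by omega), coeff_succ_shift (by omega), coeff_succ_shift hl]
      rcases l with _ | l
      · rw [lowMap_fst_zero, coeff_zero_shift, add_zero]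
      · rw [lowMap_fst_succ _ (by omega), coeff_succ_shift (by omega)]
  · rw [yRight_apply, lowMap_snd _ hl, map_add, map_smul, coeff_succ_shift (by omega)]
    rcases l with _ | l
    · rw [lowMap_fst_zero, coeff_zero_shift, coeff_zero_shift]
      simp
    · rw [lowMap_fst_succ _ (by omega), coeff_succ_shift hl, lowMap_snd _ (by omega)]
      -- At l + 1 = p the truncation in M(W,p) is matched by d_p = 0.
      have h1 : D.lowCoeff p (l + 1) • coeff k p (l + 1) (shift k V p q.2) =
          D.lowCoeff p (l + 1) • coeff k p l q.2 := by
        by_cases h : l + 1 < p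
        · rw [coeff_succ_shift h]
        · rw [show l + 1 = p by omega, lowCoeff_self, zero_smul, zero_smul]
      rw [h1, qInt_succ', lowCoeff_succ]
      module

theorem lowMap_gr (p : ℕ) (h : G) (q : (Fin (p + 2) → V) × (Fin p → V)) :
    D.lowMap p (D.grAct ρ (p + 2) h q.1, D.grAct (twist D.χ⁻¹ ρ) p h q.2) =
      D.grPair ρ (p + 1) h (D.lowMap p q) := by
  refine Prod.ext (coeff_ext (k := k) fun l hl => ?_) (coeff_ext (k := k) fun l hl => ?_)
  · rw [grPair_apply, coeff_grAct]
    rcases l with _ | l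
    · rw [lowMap_fst_zero, lowMap_fst_zero, coeff_grAct]
    · rw [lowMap_fst_succ _ (by omega), lowMap_fst_succ _ (by omega), grAct_twist, map_smul,
        coeff_grAct, coeff_grAct, map_add]
      module
  · rw [grPair_apply, map_smul, coeff_grAct, lowMap_snd _ hl, lowMap_snd _ hl, grAct_twist,
      map_smul, coeff_grAct, coeff_grAct, map_add, map_smul, map_smul]
    module

end

/-! ### Assembling the isomorphisms of H-modules -/

section tensor

variable {D} {V : Type w} [AddCommGroup V] [Module k V] (ρ : Representation k G V) [Finite G]
  {U : Type*} [AddCommGroup U] [Module k U] {π : Representation k G U}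
  (hD : D.IsNilpotentType) (hn : 2 ≤ D.n)
  {W : Type*} [AddCommGroup W] [Module k W] {σ : Representation k G W}

theorem nonempty_tensor_comm (e : π.Equiv (Representation.trivial k G k))
    {j : ℕ} (hj : j ≤ D.n) :
    Nonempty (HTensor k D.H (Mod hD π 2 hn) (Mod hD ρ j hj) ≃ₗ[D.H]
      HTensor k D.H (Mod hD ρ j hj) (Mod hD π 2 hn)) :=
  nonempty_left_equiv_right ρ hD hj hn e (D.swapEquiv ρ j) (D.swapEquiv_yLeft ρ j)
    (D.swapEquiv_grPair ρ j)

theorem nonempty_tensor_top (e : π.Equiv (Representation.trivial k G k))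
    (f : (twist D.χ⁻¹ ρ).Equiv σ) :
    Nonempty (HTensor k D.H (Mod hD ρ D.n le_rfl) (Mod hD π 2 hn) ≃ₗ[D.H]
      Mod hD ρ D.n le_rfl × Mod hD σ D.n le_rfl) := by
  obtain ⟨E⟩ := nonempty_right_equiv_prod ρ hD le_rfl hn (twist D.χ⁻¹ ρ) e le_rfl le_rfl
    (D.topEquiv D.n) (D.topEquiv_y (qInt_eq_zero D.isPrimitiveRoot_inv hn)) (D.topEquiv_gr ρ D.n)
  obtain ⟨F⟩ := Mod.nonempty_congr _ hD (le_refl D.n) f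
  exact ⟨E.trans ((LinearEquiv.refl _ _).prodCongr F)⟩

theorem nonempty_tensor_low (e : π.Equiv (Representation.trivial k G k))
    (f : (twist D.χ⁻¹ ρ).Equiv σ) {p : ℕ} (hp : p + 2 ≤ D.n) :
    Nonempty (HTensor k D.H (Mod hD ρ (p + 1) (by omega)) (Mod hD π 2 hn) ≃ₗ[D.H]
      Mod hD ρ (p + 2) hp × Mod hD σ p (by omega)) := by
  -- Here j = p + 1 < n, so [j] ≠ 0 and the first summand has length j + 1.
  have h0 := qInt_ne_zero D.isPrimitiveRoot_inv p.succ_pos (by omega)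
  obtain ⟨E⟩ := nonempty_right_equiv_prod ρ hD (by omega) hn (twist D.χ⁻¹ ρ) e hp (by omega)
    (LinearEquiv.ofBijective (D.lowMap p) ⟨D.lowMap_injective h0, D.lowMap_surjective h0⟩)
    (D.lowMap_y p) (D.lowMap_gr ρ p)
  obtain ⟨F⟩ := Mod.nonempty_congr _ hD (show p ≤ D.n by omega) f
  exact ⟨E.trans ((LinearEquiv.refl _ _).prodCongr F)⟩

end tensor

end GroupDatum

end RankOne

theorem mainTheorem6 {k : Type u} [Field k] [IsAlgClosed k] [CharZero k]
    {G : Type v} [Group G] [Finite G]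
    (D : RankOne.GroupDatum k G) (hD : D.IsNilpotentType) (hn : 2 ≤ D.n)
    {m : ℕ} {V : Fin m → Type u} [∀ i, AddCommGroup (V i)] [∀ i, Module k (V i)]
    (ρ : ∀ i, Representation k G (V i)) (hρ : RankOne.IsCompleteIrreps ρ)
    (one : Fin m) (hone : Nonempty ((ρ one).Equiv (Representation.trivial k G k)))
    (i : Fin m) :
    (∀ (j : ℕ) (_ : 2 ≤ j) (hj : j + 1 ≤ D.n),
      Nonempty
        (RankOne.HTensor k D.H (RankOne.GroupDatum.Mod hD (ρ one) 2 hn)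
            (RankOne.GroupDatum.Mod hD (ρ i) j (by omega)) ≃ₗ[D.H]
          RankOne.HTensor k D.H (RankOne.GroupDatum.Mod hD (ρ i) j (by omega))
            (RankOne.GroupDatum.Mod hD (ρ one) 2 hn)) ∧
      Nonempty
        (RankOne.HTensor k D.H (RankOne.GroupDatum.Mod hD (ρ i) j (by omega))
            (RankOne.GroupDatum.Mod hD (ρ one) 2 hn) ≃ₗ[D.H]
          RankOne.GroupDatum.Mod hD (ρ i) (j + 1) hj ×
            RankOne.GroupDatum.Mod hD (ρ (RankOne.tau hρ D i)) (j - 1) (by omega))) ∧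
    (Nonempty
        (RankOne.HTensor k D.H (RankOne.GroupDatum.Mod hD (ρ one) 2 hn)
            (RankOne.GroupDatum.Mod hD (ρ i) D.n le_rfl) ≃ₗ[D.H]
          RankOne.HTensor k D.H (RankOne.GroupDatum.Mod hD (ρ i) D.n le_rfl)
            (RankOne.GroupDatum.Mod hD (ρ one) 2 hn)) ∧
      Nonempty
        (RankOne.HTensor k D.H (RankOne.GroupDatum.Mod hD (ρ i) D.n le_rfl)
            (RankOne.GroupDatum.Mod hD (ρ one) 2 hn) ≃ₗ[D.H]
          RankOne.GroupDatum.Mod hD (ρ i) D.n le_rfl ×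
            RankOne.GroupDatum.Mod hD (ρ (RankOne.tau hρ D i)) D.n le_rfl)) := by
  obtain ⟨e⟩ := hone
  obtain ⟨f⟩ := RankOne.tau_spec hρ D i
  -- The decompositions produce the twist of V_i by χ⁻¹; this identifies it with V_τ(i).
  have f' := (RankOne.charTensorEquiv D.χ⁻¹ (ρ i)).symm.trans f
  refine ⟨fun j hj2 hj => ⟨?_, ?_⟩, ?_, ?_⟩
  · exact RankOne.GroupDatum.nonempty_tensor_comm (ρ i) hD hn e _
  · obtain ⟨p, rfl⟩ : ∃ p, j = p + 1 := ⟨j - 1, by omega⟩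
    exact RankOne.GroupDatum.nonempty_tensor_low (ρ i) hD hn e f' hj
  · exact RankOne.GroupDatum.nonempty_tensor_comm (ρ i) hD hn e _
  · exact RankOne.GroupDatum.nonempty_tensor_top (ρ i) hD hn e f'
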